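/- Let $X$ be a metrizable space that is strongly countably dimensional, i.e. there are closed sets $X_n\subseteq X$ ($n\in\mathbb N$, $n\ge 1$) with $X=\bigcup_{n=1}^\infty X_n$ and $\dim X_n<n$ for every $n$, where $\dim$ is the Čech–Lebesgue covering dimension ($\dim T<n$ means: every finite functionally open cover of $T$ has a finite functionally open refinement that covers $T$ and such that every point of $T$ lies in at most $n$ of its members). Let $Y$ be a topological space, and let $(Z,\lambda)$ be an equiconnected space, i.e. $Z$ is a topological space and $\lambda:Z\times Z\times[0,1]\to Z$ is a continuous map with $\lambda(x,y,0)=x$, $\lambda(x,y,1)=y$ and $\lambda(x,x,t)=x$ for all $x,y\in Z$, $t\in[0,1]$. For topological spaces $S,T$ let $B_0(S,T)$ be the set of continuous maps $S\to T$, and for a countable ordinal $\alpha>0$ let $B_\alpha(S,T)$ be the set of pointwise limits of sequences of maps from $\bigcup_{\xi<\alpha}B_\xi(S,T)$. Then $(X,Y,Z)$ is a Rudin $\alpha$-triple for every ordinal $0\le\alpha<\omega_1$. That is: if $f:X\times Y\to Z$ is such that $f(\cdot,y):X\to Z$ is continuous for every $y\in Y$ and the set $\{x\in X: f(x,\cdot)\in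 B_\alpha(Y,Z)\}$ is dense in $X$, then $f\in B_{\alpha+1}(X\times Y,Z)$. -/

import Mathlib

open Set Filter Topology
open scoped Ordinal

universe u v w

/-- The Baire classes `B_α(X, Y)`: `B_0(X, Y)` consists of the continuous maps, and for `α > 0`
a map is in `B_α(X, Y)` if it is the pointwise limit of a sequence of maps, each of which belongs
to `B_ξ(X, Y)` for some `ξ < α`. -/
inductive IsBaireClass {X : Type u} {Y : Type v} [TopologicalSpace X] [TopologicalSpace Y] :
    Ordinal.{0} → (X → Y) → Prop
  | of_continuous {f : X → Y} (hf : Continuous f) : IsBaireClass 0 f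
  | of_tendsto {α : Ordinal.{0}} {f : X → Y} (hα : 0 < α) (ξ : ℕ → Ordinal.{0}) (g : ℕ → X → Y)
      (hξ : ∀ n, ξ n < α) (hg : ∀ n, IsBaireClass (ξ n) (g n))
      (hlim : ∀ x, Tendsto (fun n => g n x) atTop (𝓝 (f x))) : IsBaireClass α f

/-- The class `C B̄_α(X × Y, Z)`: the maps `f : X × Y → Z` such that `f (·, y)` is continuous for
every `y`, and `f (x, ·)` is of Baire class `α` for all `x` in a dense subset of `X`. -/
def IsVerticallyNearly {X : Type u} {Y : Type v} {Z : Type w} [TopologicalSpace X]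
    [TopologicalSpace Y] [TopologicalSpace Z] (α : Ordinal.{0}) (f : X × Y → Z) : Prop :=
  (∀ y : Y, Continuous fun x : X => f (x, y)) ∧
    Dense {x : X | IsBaireClass α fun y : Y => f (x, y)}

/-- `(X, Y, Z)` is a Rudin `α`-triple: `C B̄_α(X × Y, Z) ⊆ B_{α+1}(X × Y, Z)`. -/
def IsRudinTriple (α : Ordinal.{0}) (X : Type u) (Y : Type v) (Z : Type w) [TopologicalSpace X]
    [TopologicalSpace Y] [TopologicalSpace Z] : Prop :=
  ∀ f : X × Y → Z, IsVerticallyNearly α f → IsBaireClass (α + 1) f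

/-- `(Z, lam)` is an equiconnected space. -/
structure IsEquiconnected {Z : Type w} [TopologicalSpace Z]
    (lam : Z × Z × unitInterval → Z) : Prop where
  continuous : Continuous lam
  apply_zero : ∀ x y : Z, lam (x, y, 0) = x
  apply_one : ∀ x y : Z, lam (x, y, 1) = y
  apply_self : ∀ (x : Z) (t : unitInterval), lam (x, x, t) = x

/-- Functionally open (co-zero) sets. -/
def IsFunctionallyOpen {X : Type u} [TopologicalSpace X] (A : Set X) : Prop :=
  ∃ f : X → unitInterval, Continuous f ∧ A = f ⁻¹' Ioc 0 1

/-- `dim X < n` for the Čech–Lebesgue covering dimension: every finite functionally open cover of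
`X` has a finite functionally open refinement (again a cover) of order at most `n - 1`, that is,
every point lies in at most `n` members of it. In particular `dim X < 0` means `X = ∅`. -/
def CoveringDimLT (X : Type u) [TopologicalSpace X] (n : ℕ) : Prop :=
  ∀ 𝒰 : Set (Set X), 𝒰.Finite → (∀ U ∈ 𝒰, IsFunctionallyOpen U) → ⋃₀ 𝒰 = univ →
    ∃ 𝒱 : Set (Set X), 𝒱.Finite ∧ (∀ V ∈ 𝒱, IsFunctionallyOpen V) ∧ ⋃₀ 𝒱 = univ ∧
      (∀ V ∈ 𝒱, ∃ U ∈ 𝒰, V ⊆ U) ∧ ∀ x : X, {V ∈ 𝒱 | x ∈ V}.ncard ≤ n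

/-- Strongly countably dimensional spaces: `X = ⋃_{n ≥ 1} X_n` with `X_n` closed in `X` and
`dim X_n < n`. The set `X_n` is `F (n - 1)` here. -/
def IsStronglyCountablyDimensional (X : Type u) [TopologicalSpace X] : Prop :=
  ∃ F : ℕ → Set X, (∀ n, IsClosed (F n)) ∧ ⋃ n, F n = univ ∧
    ∀ n : ℕ, CoveringDimLT (F n) (n + 1)

/-! Let `D` be the dense set of `x` with `f (x, ·)` of class `α`. For each `n`, cover `X` by
countably many open sets carrying locally constant choices `p k x ∈ D` within `1 / (n + 1)` of `x`,
and fold the values `f (p k x, y)` by `lam` with bump functions as weights. Local constancy and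
local finiteness keep the fold in class `α` (`isBaireClass_equiFold`). Each application of `lam` may
lose closeness to `f (x, y)`, so convergence needs a bound, independent of `n`, on the number of
nontrivial steps at `x`. This is what strong countable dimensionality provides
(`exists_order_bound`); `exists_nhds_equiFold` then gives the limit. -/

/-! ### Baire classes along a cofinal sequence of ordinals. -/

theorem Ordinal.exists_monotone_cofinal_seq {α : Ordinal.{0}} (h0 : 0 < α) (hα : α < ω₁) :
    ∃ β : ℕ → Ordinal.{0}, Monotone β ∧ (∀ m, β m < α) ∧ ∀ ξ < α, ∃ m, ξ ≤ β m := by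
  have hc : Countable (Iio α) := by
    rw [← Cardinal.mk_le_aleph0_iff, Cardinal.mk_Iio_ordinal, Cardinal.lift_le_aleph0]
    rw [Cardinal.lt_omega_iff_card_lt] at hα
    rwa [← Cardinal.aleph_zero, ← Order.lt_succ_iff, Cardinal.succ_aleph, zero_add]
  have : Nonempty (Iio α) := ⟨⟨0, h0⟩⟩
  obtain ⟨e, he⟩ := exists_surjective_nat (Iio α)
  refine ⟨partialSups fun n => (e n : Ordinal), (partialSups _).monotone, fun m => ?_,
    fun ξ hξ => ?_⟩
  · induction m with
    | zero =>
      rw [partialSups_zero]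
      exact (e 0).2
    | succ m ih =>
      rw [partialSups_add_one]
      exact max_lt ih (e (m + 1)).2
  · obtain ⟨m, hm⟩ := he ⟨ξ, hξ⟩
    refine ⟨m, le_trans ?_ (le_partialSups (fun n => (e n : Ordinal)) m)⟩
    simp [hm]

namespace IsBaireClass

variable {X : Type u} {Y : Type v} [TopologicalSpace X] [TopologicalSpace Y]

theorem mono {ξ α : Ordinal.{0}} {f : X → Y} (hf : IsBaireClass ξ f) (h : ξ ≤ α) :
    IsBaireClass α f := by
  rcases h.eq_or_lt with rfl | h
  · exact hf
  · exact .of_tendsto (bot_le.trans_lt h) (fun _ => ξ) (fun _ => f) (fun _ => h) (fun _ => hf)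
      fun _ => tendsto_const_nhds

theorem continuous {f : X → Y} (hf : IsBaireClass 0 f) : Continuous f := by
  cases hf with
  | of_continuous hf => exact hf
  | of_tendsto h => exact absurd h (lt_irrefl _)

/-- The approximating sequence of a map of Baire class `α` can be chosen along any prescribed
monotone cofinal sequence of ordinals. -/
theorem exists_seq_tendsto {α : Ordinal.{0}} (h0 : 0 < α) {β : ℕ → Ordinal.{0}} (hβ : Monotone β)
    (hcof : ∀ ξ < α, ∃ m, ξ ≤ β m) (y₀ : Y) {f : X → Y} (hf : IsBaireClass α f) :
    ∃ g : ℕ → X → Y, (∀ m, IsBaireClass (β m) (g m)) ∧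
      ∀ x, Tendsto (fun m => g m x) atTop (𝓝 (f x)) := by
  classical
  cases hf with
  | of_continuous hf => exact absurd h0 (lt_irrefl _)
  | of_tendsto _ ξ g hξ hg hlim =>
    -- Slow the given sequence down: use the last term, of index at most `m`, whose class `β m`
    -- already allows. The constant `y₀` fills in while there is none.
    let l : ℕ → ℕ := fun m => Nat.findGreatest (fun i => ξ i ≤ β m) m
    refine ⟨fun m => if ξ (l m) ≤ β m then g (l m) else fun _ => y₀, fun m => ?_, fun x => ?_⟩
    · dsimp only
      split_ifs with h
      · exact (hg _).mono h
      · exact (of_continuous continuous_const).mono bot_le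
    · have key : ∀ L, ∀ᶠ m in atTop, L ≤ l m ∧ ξ (l m) ≤ β m := fun L => by
        obtain ⟨M, hM⟩ := hcof _ (hξ L)
        filter_upwards [eventually_ge_atTop (max M L)] with m hm
        have h1 : ξ L ≤ β m := hM.trans (hβ ((le_max_left _ _).trans hm))
        have h2 : L ≤ m := (le_max_right _ _).trans hm
        exact ⟨Nat.le_findGreatest h2 h1,
          Nat.findGreatest_spec (P := fun i => ξ i ≤ β m) h2 h1⟩
      have hl : Tendsto l atTop atTop :=
        tendsto_atTop.2 fun L => (key L).mono fun _ h => h.1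
      refine ((hlim x).comp hl).congr' ?_
      filter_upwards [key 0] with m hm
      simp [hm.2]

end IsBaireClass

/-! ### Folding in equiconnected spaces. -/

/-- The iterated combination `z₀, lam (z₀, w 0, t 0), lam (lam (z₀, w 0, t 0), w 1, t 1), …`. -/
def equiFold {Z : Type w} (lam : Z × Z × unitInterval → Z) (z₀ : Z) (t : ℕ → unitInterval)
    (w : ℕ → Z) : ℕ → Z
  | 0 => z₀
  | k + 1 => lam (equiFold lam z₀ t w k, w k, t k)

namespace IsEquiconnected

variable {X : Type u} {Y : Type v} {Z : Type w} [TopologicalSpace X] [TopologicalSpace Y]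
  [TopologicalSpace Z] {lam : Z × Z × unitInterval → Z}

theorem equiFold_eq_of_le (hlam : IsEquiconnected lam) (z₀ : Z) {t : ℕ → unitInterval} (w : ℕ → Z)
    {K L : ℕ} (ht : ∀ k ≥ K, t k = 0) (h : K ≤ L) :
    equiFold lam z₀ t w L = equiFold lam z₀ t w K := by
  induction L, h using Nat.le_induction with
  | base => rfl
  | succ L hL ih => rw [equiFold, ht L hL, hlam.apply_zero, ih]

theorem equiFold_eq (hlam : IsEquiconnected lam) (z₀ : Z) {t : ℕ → unitInterval} (w : ℕ → Z)
    {K L : ℕ} (hK : ∀ k ≥ K, t k = 0) (hL : ∀ k ≥ L, t k = 0) :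
    equiFold lam z₀ t w L = equiFold lam z₀ t w K := by
  rcases le_total K L with h | h
  · exact hlam.equiFold_eq_of_le z₀ w hK h
  · exact (hlam.equiFold_eq_of_le z₀ w hL h).symm

theorem tendsto_equiFold (hlam : IsEquiconnected lam) (z₀ : Z) (t : ℕ → unitInterval)
    {ι : Type*} {l : Filter ι} {w : ι → ℕ → Z} {w' : ℕ → Z}
    (hw : ∀ k, Tendsto (fun i => w i k) l (𝓝 (w' k))) (K : ℕ) :
    Tendsto (fun i => equiFold lam z₀ t (w i) K) l (𝓝 (equiFold lam z₀ t w' K)) := by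
  induction K with
  | zero => exact tendsto_const_nhds
  | succ K ih =>
    exact (hlam.continuous.tendsto _).comp
      (ih.prodMk_nhds ((hw K).prodMk_nhds tendsto_const_nhds))

/-- Folding maps that are chosen in a locally constant way preserves the Baire classes. -/
theorem isBaireClass_equiFold (hlam : IsEquiconnected lam) (z₀ : Z) {ι : Type*} {W : ℕ → Set X}
    {p : ℕ → X → ι} (hp : ∀ k, ∀ x ∈ W k, ∀ᶠ x' in 𝓝 x, p k x' = p k x)
    {φ : ℕ → X → unitInterval} (hφ : ∀ k, Continuous (φ k))
    (hsupp : ∀ k, ∀ x ∉ W k, ∀ᶠ x' in 𝓝 x, φ k x' = 0)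
    (hfin : ∀ x, ∃ N, ∀ᶠ x' in 𝓝 x, ∀ k ≥ N, φ k x' = 0)
    {K : X → ℕ} (hK : ∀ x, ∀ k ≥ K x, φ k x = 0) {α : Ordinal.{0}} (hα : α < ω₁)
    {h : ι → Y → Z} (hh : ∀ d, IsBaireClass α (h d)) :
    IsBaireClass α fun q : X × Y =>
      equiFold lam z₀ (fun k => φ k q.1) (fun k => h (p k q.1) q.2) (K q.1) := by
  induction α using WellFoundedLT.induction generalizing h with
  | ind α ih =>
  rcases eq_bot_or_bot_lt α with rfl | h0
  · refine .of_continuous ?_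
    have hcont : ∀ N, Continuous fun q : X × Y =>
        equiFold lam z₀ (fun k => φ k q.1) (fun k => h (p k q.1) q.2) N := by
      intro N
      induction N with
      | zero => exact continuous_const
      | succ N ihN =>
        refine continuous_iff_continuousAt.2 fun q => ?_
        by_cases hq : q.1 ∈ W N
        · have h1 : ContinuousAt (fun q' : X × Y => h (p N q'.1) q'.2) q := by
            have h2 : ContinuousAt (fun q' : X × Y => h (p N q.1) q'.2) q :=
              ((hh _).continuous.comp continuous_snd).continuousAt
            refine h2.congr ?_
            filter_upwards [continuous_fst.continuousAt.eventually (hp N q.1 hq)] with q' hq'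
            rw [hq']
          exact hlam.continuous.continuousAt.comp (f := fun q : X × Y => (_, _, _))
            (ihN.continuousAt.prodMk (h1.prodMk ((hφ N).comp continuous_fst).continuousAt))
        -- Off `W N` the choice `p N` may jump, but the weight vanishes nearby and the step is
        -- trivial.
        · refine ihN.continuousAt.congr ?_
          filter_upwards [continuous_fst.continuousAt.eventually (hsupp N q.1 hq)] with q' hq'
          rw [equiFold, hq', hlam.apply_zero]
    refine continuous_iff_continuousAt.2 fun q => ?_
    obtain ⟨N, hN⟩ := hfin q.1
    refine (hcont N).continuousAt.congr ?_
    filter_upwards [continuous_fst.continuousAt.eventually hN] with q' hq'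
    exact hlam.equiFold_eq _ _ (hK q'.1) hq'
  · obtain ⟨β, hβ, hβα, hcof⟩ := Ordinal.exists_monotone_cofinal_seq h0 hα
    -- One `β` serves all `d`: unrelated sequences of classes could have supremum `α` over `d` at a
    -- fixed stage.
    choose g hg hlim using fun d => (hh d).exists_seq_tendsto h0 hβ hcof z₀
    refine .of_tendsto h0 β (fun m q => equiFold lam z₀ (fun k => φ k q.1)
      (fun k => g (p k q.1) m q.2) (K q.1)) hβα (fun m => ?_) fun q => ?_
    · exact ih (β m) (hβα m) ((hβα m).trans hα) fun d => hg d m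
    · exact hlam.tendsto_equiFold _ _ (fun k => hlim _ _) _

/-- Tube lemma: `lam` sends the compact set `{(z, z)} × [0, 1]` to `z`. -/
theorem exists_nhds (hlam : IsEquiconnected lam) {z : Z} {N : Set Z} (hN : N ∈ 𝓝 z) :
    ∃ M ∈ 𝓝 z, ∀ a ∈ M, ∀ b ∈ M, ∀ t, lam (a, b, t) ∈ N := by
  have h : ∀ᶠ q : Z × Z in 𝓝 (z, z), ∀ t ∈ (univ : Set unitInterval), lam (q.1, q.2, t) ∈ N := by
    refine isCompact_univ.eventually_forall_of_forall_eventually fun t _ => ?_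
    have : Tendsto (fun q : (Z × Z) × unitInterval => lam (q.1.1, q.1.2, q.2)) (𝓝 ((z, z), t))
        (𝓝 z) := by
      have := (hlam.continuous.comp (f := fun q : (Z × Z) × unitInterval => (q.1.1, q.1.2, q.2))
        (by fun_prop)).tendsto ((z, z), t)
      simpa only [Function.comp_def, hlam.apply_self] using this
    exact this hN
  rw [nhds_prod_eq] at h
  obtain ⟨M, hM, hMN⟩ := mem_prod_self_iff.1 h
  exact ⟨M, hM, fun a ha b hb t => hMN (mk_mem_prod ha hb) t (mem_univ t)⟩

/-- A fold of length `c` of points close to `z`, started anew by a weight `1`, is close to `z`. -/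
theorem exists_nhds_equiFold (hlam : IsEquiconnected lam) {z : Z} {N : Set Z} (hN : N ∈ 𝓝 z)
    (c : ℕ) : ∃ M ∈ 𝓝 z, ∀ (z₀ : Z) (t : ℕ → unitInterval) (w : ℕ → Z) (s : Finset ℕ),
      s.card ≤ c → (∀ k ∉ s, t k = 0) → (∀ k ∈ s, w k ∈ M) → (∃ k, t k = 1) →
      ∀ L, (∀ k ≥ L, t k = 0) → equiFold lam z₀ t w L ∈ N := by
  choose! S hS hSlam using fun N (hN : N ∈ 𝓝 z) => hlam.exists_nhds hN
  let V : ℕ → Set Z := fun i => S^[i] N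
  have hV : ∀ i, V i ∈ 𝓝 z := fun i => by
    induction i with
    | zero => exact hN
    | succ i ih => simpa only [V, Function.iterate_succ_apply'] using hS _ ih
  have hVlam : ∀ i, ∀ a ∈ V (i + 1), ∀ b ∈ V (i + 1), ∀ t, lam (a, b, t) ∈ V i := fun i => by
    simpa only [V, Function.iterate_succ_apply'] using hSlam _ (hV i)
  have hVanti : Antitone V := antitone_nat_of_succ_le fun i a ha => by
    simpa [hlam.apply_self] using hVlam i a ha a ha 0
  refine ⟨V c, hV c, fun z₀ t w s hs hts hws ⟨k₀, hk₀⟩ L hL => ?_⟩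
  have hmem : ∀ k, t k ≠ 0 → k ∈ s := fun k hk => by_contra fun h => hk (hts k h)
  -- The weight `1` at `k₀` discards all earlier values; afterwards each nonzero weight costs at
  -- most one level of `V`.
  have key : ∀ k, k₀ < k →
      equiFold lam z₀ t w k ∈ V (c - (s.filter fun i => k₀ < i ∧ i < k).card) := by
    intro k hk
    induction k, hk using Nat.le_induction with
    | base =>
      rw [equiFold, hk₀, hlam.apply_one]
      exact hVanti (Nat.sub_le _ _) (hws _ (hmem _ (by simp [hk₀])))
    | succ k hk ih =>
      have hk : k₀ < k := hk
      by_cases htk : t k = 0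
      · rw [equiFold, htk, hlam.apply_zero]
        refine hVanti (Nat.sub_le_sub_left (Finset.card_le_card ?_) c) ih
        exact Finset.monotone_filter_right _ fun i _ h => ⟨h.1, h.2.trans k.lt_succ_self⟩
      · have hks := hmem k htk
        have hlt : (s.filter fun i => k₀ < i ∧ i < k).card <
            (s.filter fun i => k₀ < i ∧ i < k + 1).card := by
          refine Finset.card_lt_card (Finset.ssubset_iff.2 ⟨k, by simp, ?_⟩)
          intro i hi
          rcases Finset.mem_insert.1 hi with rfl | hi
          · simp [hks, hk]
          · simp only [Finset.mem_filter] at hi ⊢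
            exact ⟨hi.1, hi.2.1, by omega⟩
        have hle : (s.filter fun i => k₀ < i ∧ i < k + 1).card ≤ c :=
          (Finset.card_filter_le _ _).trans hs
        refine hVlam _ _ (hVanti (by omega) ih) _ (hVanti (Nat.le_trans (by omega) le_rfl)
          (hws _ hks)) _
  have hk₀L : k₀ < L := by
    by_contra h
    simpa [hk₀] using hL k₀ (not_lt.1 h)
  exact hVanti (Nat.zero_le _) (key L hk₀L)

end IsEquiconnected

/-! ### Locally constant approximation by points of a dense set. -/

/-- Open covers by small sets on each of which a locally constant nearby point of `D` is chosen:
the sets come from Stone's `σ`-discrete refinement of the cover by the balls around points of `D`. -/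
theorem exists_locallyConstant_approx {X : Type u} [MetricSpace X] {D : Set X} (hD : Dense D)
    {ε : ℝ} (hε : 0 < ε) (d₀ : D) :
    ∃ (W : ℕ → Set X) (p : ℕ → X → D), (∀ k, IsOpen (W k)) ∧ ⋃ k, W k = univ ∧
      (∀ k, ∀ x ∈ W k, ∀ᶠ x' in 𝓝 x, p k x' = p k x) ∧
      ∀ k, ∀ x ∈ W k, dist (p k x : X) x < ε := by
  classical
  let r : D → D → Prop := WellOrderingRel
  let δ : ℕ → ℝ := fun k => 1 / (k + 1 : ℝ)
  have hδ : ∀ k, 0 < δ k := fun k => Nat.one_div_pos_of_nat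
  let S : ℕ → D → Set X := fun k d =>
    {x | Metric.ball x (δ k) ⊆ Metric.ball (d : X) ε ∧ ∀ e, r e d → x ∉ Metric.ball (e : X) ε}
  let T : ℕ → D → Set X := fun k d => Metric.thickening (δ k / 2) (S k d)
  -- For distinct `d`, `e`, points of `S k d` and `S k e` are at least `δ k` apart, so the
  -- thickenings by half of it are disjoint.
  have hdisj : ∀ k d e x, x ∈ T k d → x ∈ T k e → d = e := by
    have key : ∀ k d e x, r d e → x ∈ T k d → x ∈ T k e → False := by
      intro k d e x hde hd he
      obtain ⟨a, ha, hxa⟩ := Metric.mem_thickening_iff.1 hd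
      obtain ⟨b, hb, hxb⟩ := Metric.mem_thickening_iff.1 he
      refine hb.2 d hde (ha.1 ?_)
      rw [Metric.mem_ball]
      calc dist b a ≤ dist x b + dist x a := dist_triangle_left _ _ _
        _ < δ k := by linarith
    intro k d e x hd he
    rcases trichotomous_of r d e with h | h | h
    · exact (key k d e x h hd he).elim
    · exact h
    · exact (key k e d x h he hd).elim
  let p : ℕ → X → D := fun k x => if h : ∃ d, x ∈ T k d then h.choose else d₀
  have hp : ∀ k d x, x ∈ T k d → p k x = d := fun k d x hx => by
    have h : ∃ d, x ∈ T k d := ⟨d, hx⟩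
    simp only [p, dif_pos h]
    exact hdisj k _ _ x h.choose_spec hx
  refine ⟨fun k => ⋃ d, T k d, p, fun k => isOpen_iUnion fun d => Metric.isOpen_thickening, ?_,
    fun k x hx => ?_, fun k x hx => ?_⟩
  · refine eq_univ_of_forall fun x => ?_
    have hne : {d : D | x ∈ Metric.ball (d : X) ε}.Nonempty := by
      obtain ⟨d, hd, hxd⟩ := hD.exists_dist_lt x hε
      exact ⟨⟨d, hd⟩, hxd⟩
    have hwf : WellFounded r := WellOrderingRel.isWellOrder.wf
    let d := hwf.min _ hne
    have hd : x ∈ Metric.ball (d : X) ε := hwf.min_mem _ hne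
    obtain ⟨η, hη, hηd⟩ := Metric.isOpen_iff.1 Metric.isOpen_ball x hd
    obtain ⟨k, hk⟩ := exists_nat_one_div_lt hη
    refine mem_iUnion.2 ⟨k, mem_iUnion.2 ⟨d, Metric.self_subset_thickening (half_pos (hδ k)) _ ?_⟩⟩
    exact ⟨(Metric.ball_subset_ball hk.le).trans hηd,
      fun e he hxe => hwf.not_lt_min _ hxe he⟩
  · obtain ⟨d, hd⟩ := mem_iUnion.1 hx
    filter_upwards [Metric.isOpen_thickening.mem_nhds hd] with x' hx'
    rw [hp k d x hd, hp k d x' hx']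
  · obtain ⟨d, hd⟩ := mem_iUnion.1 hx
    rw [hp k d x hd]
    obtain ⟨a, ha, hxa⟩ := Metric.mem_thickening_iff.1 hd
    have : x ∈ Metric.ball (d : X) ε := ha.1 (by
      rw [Metric.mem_ball]; linarith [hδ k])
    rw [dist_comm]
    exact this

/-! ### Covering dimension and refinements of bounded order. -/

theorem IsFunctionallyOpen.isOpen {X : Type u} [TopologicalSpace X] {A : Set X}
    (h : IsFunctionallyOpen A) : IsOpen A := by
  obtain ⟨f, hf, rfl⟩ := h
  have : (Ioc 0 1 : Set unitInterval) = Ioi 0 := by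
    ext t
    simp [unitInterval.le_one']
  rw [this]
  exact isOpen_Ioi.preimage hf

theorem IsOpen.isFunctionallyOpen {X : Type u} [PseudoMetricSpace X] {A : Set X}
    (h : IsOpen A) : IsFunctionallyOpen A := by
  rcases (Aᶜ).eq_empty_or_nonempty with hA | hA
  · refine ⟨fun _ => 1, continuous_const, ?_⟩
    rw [compl_empty_iff.1 hA]
    ext; simp
  · refine ⟨fun x => projIcc 0 1 zero_le_one (Metric.infDist x Aᶜ),
      continuous_projIcc.comp (Metric.continuous_infDist_pt _), ?_⟩
    ext x
    have h1 := h.isClosed_compl.notMem_iff_infDist_pos hA (x := x)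
    rw [notMem_compl_iff] at h1
    have h2 : (0 : unitInterval) = projIcc 0 1 zero_le_one 0 := by simp
    rw [mem_preimage, mem_Ioc, h1, and_iff_left unitInterval.le_one', ← Subtype.coe_lt_coe,
      coe_projIcc]
    simp

/-- A finite open cover of a closed subset of dimension `< n` has a refinement by open sets of the
whole space whose order is controlled everywhere. -/
theorem CoveringDimLT.exists_open_refinement {X : Type u} [MetricSpace X] {A : Set X}
    (hA : IsClosed A) {n : ℕ} (hn : CoveringDimLT A n) {ι : Type*} [Finite ι] {U : ι → Set X}
    (hU : ∀ i, IsOpen (U i)) (hAU : A ⊆ ⋃ i, U i) :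
    ∃ V : ι → Set X, (∀ i, IsOpen (V i)) ∧ (∀ i, V i ⊆ U i) ∧ A ⊆ ⋃ i, V i ∧
      ∀ x, {i | x ∈ V i}.ncard ≤ n := by
  classical
  obtain ⟨𝒱, h𝒱, hopen, hcov, href, hord⟩ := hn (range fun i => ((↑) : A → X) ⁻¹' U i)
    (finite_range _) (by
      rintro _ ⟨i, rfl⟩
      exact ((hU i).preimage continuous_subtype_val).isFunctionallyOpen) (by
      refine eq_univ_of_forall fun a => ?_
      obtain ⟨i, hi⟩ := mem_iUnion.1 (hAU a.2)
      exact ⟨_, ⟨i, rfl⟩, hi⟩)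
  have href' : ∀ V ∈ 𝒱, ∃ i, V ⊆ ((↑) : A → X) ⁻¹' U i := fun V hV => by
    obtain ⟨_, ⟨i, rfl⟩, h⟩ := href V hV
    exact ⟨i, h⟩
  rcases isEmpty_or_nonempty ι with hι | hι
  · exact ⟨U, hU, fun _ => Subset.rfl, hAU, fun x => by simp [Set.eq_empty_of_isEmpty]⟩
  choose! σ hσ using href'
  let P : ι → Set A := fun i => ⋃₀ {V ∈ 𝒱 | σ V = i}
  have hPopen : ∀ i, IsOpen (P i) := fun i => isOpen_sUnion fun V hV => (hopen V hV.1).isOpen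
  have hPU : ∀ i, P i ⊆ ((↑) : A → X) ⁻¹' U i := fun i => sUnion_subset fun V hV => by
    rw [← hV.2]
    exact hσ V hV.1
  let C : ι → Set X := fun i => ((↑) : A → X) '' (P i)ᶜ
  have hC : ∀ i, IsClosed (C i) := fun i =>
    hA.isClosedEmbedding_subtypeVal.isClosedMap _ (hPopen i).isClosed_compl
  -- `E i` extends `P i` from `A` to an open set of `X`. For given `x`, a point `a ∈ A` nearer to
  -- `x` than every relevant `C i` lies in all the corresponding `P i`, so the order at `x` is
  -- bounded by that at `a`.
  let E : ι → Set X := fun i => {x | Metric.infEDist x A < Metric.infEDist x (C i)}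
  refine ⟨fun i => E i ∩ U i, fun i => (isOpen_lt Metric.continuous_infEDist
    Metric.continuous_infEDist).inter (hU i), fun i => inter_subset_right, fun a ha => ?_,
    fun x => ?_⟩
  · obtain ⟨V, hV, haV⟩ : (⟨a, ha⟩ : A) ∈ ⋃₀ 𝒱 := hcov ▸ mem_univ _
    have haP : (⟨a, ha⟩ : A) ∈ P (σ V) := ⟨V, ⟨hV, rfl⟩, haV⟩
    refine mem_iUnion.2 ⟨σ V, ?_, hPU _ haP⟩
    change Metric.infEDist a A < Metric.infEDist a (C (σ V))
    rw [Metric.infEDist_zero_of_mem ha, pos_iff_ne_zero, Ne,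
      ← Metric.mem_iff_infEDist_zero_of_closed (hC _)]
    rintro ⟨b, hb, rfl⟩
    exact hb haP
  · change {i | x ∈ E i ∩ U i}.ncard ≤ n
    rcases {i | x ∈ E i ∩ U i}.eq_empty_or_nonempty with h0 | h0
    · rw [h0, ncard_empty]
      exact Nat.zero_le n
    obtain ⟨i₀, hi₀, hmin⟩ := exists_min_image {i | x ∈ E i ∩ U i}
      (fun i => Metric.infEDist x (C i)) (toFinite _) h0
    obtain ⟨a, ha, hxa⟩ := Metric.infEDist_lt_iff.1 hi₀.1
    have hmem : ∀ i, x ∈ E i ∩ U i → ∃ V ∈ 𝒱, σ V = i ∧ (⟨a, ha⟩ : A) ∈ V := by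
      intro i hi
      have : (⟨a, ha⟩ : A) ∈ P i := by
        by_contra h
        have h1 : Metric.infEDist x (C i) ≤ edist x a :=
          Metric.infEDist_le_edist_of_mem ⟨⟨a, ha⟩, h, rfl⟩
        exact absurd (hxa.trans_le (hmin i hi)) (not_lt.2 h1)
      obtain ⟨V, hV, haV⟩ := this
      exact ⟨V, hV.1, hV.2, haV⟩
    calc {i | x ∈ E i ∩ U i}.ncard ≤ (σ '' {V ∈ 𝒱 | (⟨a, ha⟩ : A) ∈ V}).ncard := by
          refine ncard_le_ncard (fun i hi => ?_) (toFinite _)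
          obtain ⟨V, hV, hVi, haV⟩ := hmem i hi
          exact ⟨V, ⟨hV, haV⟩, hVi⟩
      _ ≤ {V ∈ 𝒱 | (⟨a, ha⟩ : A) ∈ V}.ncard := ncard_image_le (h𝒱.subset fun V hV => hV.1)
      _ ≤ n := hord _

/-- The countable version of `CoveringDimLT.exists_open_refinement`, with a weaker bound. -/
theorem CoveringDimLT.exists_open_refinement_nat {X : Type u} [MetricSpace X] {A : Set X}
    (hA : IsClosed A) {n : ℕ} (hn : CoveringDimLT A n) {W : ℕ → Set X}
    (hW : ∀ k, IsOpen (W k)) (hcov : ⋃ k, W k = univ) :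
    ∃ O : ℕ → Set X, (∀ k, IsOpen (O k)) ∧ (∀ k, O k ⊆ W k) ∧ A ⊆ ⋃ k, O k ∧
      ∀ x, {k | x ∈ O k}.encard ≤ (2 * n : ℕ) := by
  classical
  have hcov' : ∀ x, ∃ k, x ∈ W k := fun x => mem_iUnion.1 (hcov ▸ mem_univ x)
  -- A continuous majorant of the first index of a member containing `x`: on `g ≤ j + 1` finitely
  -- many `W k` suffice.
  obtain ⟨g, hg⟩ := exists_continuous_forall_mem_convex_of_local_const
    (t := fun x : X => Ici ((Nat.find (hcov' x) : ℕ) : ℝ)) (fun x => convex_Ici _) fun x => by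
      obtain ⟨k, hk⟩ := hcov' x
      refine ⟨k, ?_⟩
      filter_upwards [(hW k).mem_nhds hk] with y hy
      exact Nat.cast_le (α := ℝ).2 (Nat.find_min' (hcov' y) hy)
  have hg0 : ∀ x, 0 ≤ g x := fun x => (Nat.cast_nonneg _).trans (hg x)
  have hgW : ∀ (j : ℕ) x, g x ≤ j + 1 → ∃ k < j + 2, x ∈ W k := fun j x h => by
    refine ⟨_, ?_, Nat.find_spec (hcov' x)⟩
    have : ((Nat.find (hcov' x) : ℕ) : ℝ) ≤ j + 1 := le_trans (hg x) h
    have : Nat.find (hcov' x) ≤ j + 1 := by exact_mod_cast this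
    omega
  choose V hVo hVU hAV hVord using fun j : ℕ =>
    hn.exists_open_refinement hA (ι := Option (Fin (j + 2)))
      (U := fun i => i.elim {x | (j + 1 : ℝ) < g x} fun k => W k)
      (by
        rintro (_ | k)
        · exact isOpen_lt continuous_const g.continuous
        · exact hW k)
      (fun x _ => by
        by_cases h : g x ≤ j + 1
        · obtain ⟨k, hk, hx⟩ := hgW j x h
          exact mem_iUnion.2 ⟨some ⟨k, hk⟩, hx⟩
        · exact mem_iUnion.2 ⟨none, not_le.1 h⟩)
  -- The band `B j` misses the auxiliary member `none`. Each point lies in at most two bands, whence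
  -- the factor `2`.
  let B : ℕ → Set X := fun j => {x | (j : ℝ) - 1 < g x ∧ g x < j + 1}
  have hB : ∀ j, IsOpen (B j) := fun j =>
    (isOpen_lt continuous_const g.continuous).inter (isOpen_lt g.continuous continuous_const)
  refine ⟨fun k => ⋃ (j : ℕ) (hk : k < j + 2), V j (some ⟨k, hk⟩) ∩ B j,
    fun k => isOpen_iUnion fun j => isOpen_iUnion fun hk => (hVo _ _).inter (hB j),
    fun k => iUnion₂_subset fun j hk x hx => hVU _ _ hx.1, fun x hx => ?_, fun x => ?_⟩
  · have hxB : x ∈ B ⌊g x⌋₊ := by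
      have h1 := Nat.floor_le (hg0 x)
      have h2 := Nat.lt_floor_add_one (g x)
      exact ⟨by linarith, h2⟩
    obtain ⟨i, hi⟩ := mem_iUnion.1 (hAV ⌊g x⌋₊ hx)
    rcases i with _ | k
    · exact absurd (hVU _ _ hi) (not_lt.2 hxB.2.le)
    · exact mem_iUnion.2 ⟨k, mem_iUnion₂.2 ⟨_, k.2, hi, hxB⟩⟩
  · let Q : ℕ → Set ℕ := fun j => (fun i => i.elim 0 Fin.val) '' {i | x ∈ V j i}
    have hQ : ∀ j, (Q j).encard ≤ n := fun j => by
      refine (encard_image_le _ _).trans ?_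
      rw [← (toFinite _).cast_ncard_eq]
      exact_mod_cast hVord j x
    calc {k | x ∈ ⋃ (j : ℕ) (hk : k < j + 2), V j (some ⟨k, hk⟩) ∩ B j}.encard
        ≤ (Q ⌊g x⌋₊ ∪ Q (⌊g x⌋₊ + 1)).encard := by
          refine encard_le_encard fun k hk => ?_
          obtain ⟨j, hk, hxV, hxB⟩ := mem_iUnion₂.1 hk
          have h1 : j < ⌊g x⌋₊ + 2 := by
            have : (j : ℝ) < ⌊g x⌋₊ + 2 := by linarith [hxB.1, Nat.lt_floor_add_one (g x)]
            exact_mod_cast this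
          have h2 : ⌊g x⌋₊ < j + 1 := by
            have : (⌊g x⌋₊ : ℝ) < j + 1 := (Nat.floor_le (hg0 x)).trans_lt hxB.2
            exact_mod_cast this
          have hkQ : k ∈ Q j := ⟨some ⟨k, hk⟩, hxV, rfl⟩
          obtain rfl | rfl : j = ⌊g x⌋₊ ∨ j = ⌊g x⌋₊ + 1 := by omega
          · exact Or.inl hkQ
          · exact Or.inr hkQ
      _ ≤ n + n := (encard_union_le _ _).trans (add_le_add (hQ _) (hQ _))
      _ = (2 * n : ℕ) := by push_cast; ring

/-- In a strongly countably dimensional space, countable open covers have refinements whose order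
at each point is bounded independently of the cover. -/
theorem IsStronglyCountablyDimensional.exists_order_bound {X : Type u} [MetricSpace X]
    (hX : IsStronglyCountablyDimensional X) :
    ∃ c : X → ℕ, ∀ W : ℕ → Set X, (∀ k, IsOpen (W k)) → ⋃ k, W k = univ →
      ∃ O : ℕ → Set X, (∀ k, IsOpen (O k)) ∧ (∀ k, O k ⊆ W k) ∧ ⋃ k, O k = univ ∧
        ∀ x, {k | x ∈ O k}.encard ≤ c x := by
  classical
  obtain ⟨F, hF, hcovF, hdim⟩ := hX
  choose m hm using fun x => mem_iUnion.1 (hcovF ▸ mem_univ x : x ∈ ⋃ n, F n)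
  refine ⟨fun x => ∑ j ∈ Finset.range (m x + 1), 2 * (j + 1), fun W hW hcov => ?_⟩
  choose O hOo hOW hFO hord using fun j =>
    (hdim j).exists_open_refinement_nat (hF j) hW hcov
  -- Removing the earlier `F i` leaves only the refinements with `j ≤ m x` at `x`, so the bounds add
  -- up to a finite sum that does not depend on `W`.
  refine ⟨fun k => ⋃ j, O j k \ ⋃ i ∈ Finset.range j, F i, fun k => isOpen_iUnion fun j =>
      (hOo j k).sdiff (isClosed_biUnion_finset fun i _ => hF i),
    fun k => iUnion_subset fun j => sdiff_subset.trans (hOW j k),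
    eq_univ_of_forall fun x => ?_, fun x => ?_⟩
  · have hex : ∃ j, x ∈ F j := ⟨_, hm x⟩
    obtain ⟨k, hk⟩ := mem_iUnion.1 (hFO _ (Nat.find_spec hex))
    refine mem_iUnion.2 ⟨k, mem_iUnion.2 ⟨_, hk, ?_⟩⟩
    simp only [mem_iUnion, Finset.mem_range, not_exists]
    exact fun i hi => Nat.find_min hex hi
  · have hsub : {k | x ∈ ⋃ j, O j k \ ⋃ i ∈ Finset.range j, F i} ⊆
        ⋃ j ∈ Finset.range (m x + 1), {k | x ∈ O j k} := by
      intro k hk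
      obtain ⟨j, hj, hjF⟩ := mem_iUnion.1 hk
      simp only [mem_iUnion, Finset.mem_range, not_exists] at hjF ⊢
      exact ⟨j, Nat.lt_succ_of_le (not_lt.1 fun h => hjF _ h (hm x)), hj⟩
    have hsum : ∀ s : Finset ℕ, (⋃ j ∈ s, {k | x ∈ O j k}).encard ≤
        ((∑ j ∈ s, 2 * (j + 1) : ℕ) : ℕ∞) := by
      intro s
      induction s using Finset.induction_on with
      | empty => simp
      | insert j s hj ih =>
        rw [Finset.set_biUnion_insert, Finset.sum_insert hj, Nat.cast_add]
        exact (encard_union_le _ _).trans (add_le_add (hord j x) ih)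
    exact (encard_le_encard hsub).trans (hsum _)

/-! ### The approximating folds and their limit. -/

theorem mainTheorem5 {X : Type u} {Y : Type v} {Z : Type w} [TopologicalSpace X]
    [TopologicalSpace.MetrizableSpace X] [TopologicalSpace Y] [TopologicalSpace Z]
    (hX : IsStronglyCountablyDimensional X)
    (lam : Z × Z × unitInterval → Z) (hlam : IsEquiconnected lam)
    (α : Ordinal.{0}) (hα : α < ω₁) :
    IsRudinTriple α X Y Z := by
  intro f ⟨hfc, hD⟩
  rcases isEmpty_or_nonempty (X × Y) with hXY | ⟨⟨x₀, y₀⟩⟩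
  · exact (IsBaireClass.of_continuous (continuous_of_const fun q => hXY.elim q)).mono bot_le
  let := TopologicalSpace.metrizableSpaceMetric X
  let D : Set X := {x : X | IsBaireClass α fun y : Y => f (x, y)}
  obtain ⟨d₀, hd₀⟩ : D.Nonempty := hD.nonempty_iff.2 ⟨x₀⟩
  let z₀ := f (x₀, y₀)
  obtain ⟨c, hc⟩ := hX.exists_order_bound
  choose W p hW hWcov hp hdist using fun n : ℕ =>
    exists_locallyConstant_approx hD (Nat.one_div_pos_of_nat (α := ℝ) (n := n)) ⟨d₀, hd₀⟩
  choose O hO hOW hOcov hOc using fun n => hc (W n) (hW n) (hWcov n)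
  -- A bump covering, not a partition of unity: at each point some bump equals `1`, which restarts
  -- the fold.
  choose b hb using fun n =>
    BumpCovering.exists_isSubordinate isClosed_univ (O n) (hO n) (hOcov n).ge
  let φ : ℕ → ℕ → X → unitInterval := fun n k x => ⟨b n k x, (b n).nonneg k x, (b n).le_one k x⟩
  have hφ0 : ∀ n k x, φ n k x = 0 ↔ b n k x = 0 := fun n k x => Subtype.ext_iff
  have hφO : ∀ n k x, x ∉ O n k → φ n k x = 0 := fun n k x hx =>
    (hφ0 n k x).2 (image_eq_zero_of_notMem_tsupport fun h => hx (hb n k h))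
  have hfin : ∀ n x, ∃ N, ∀ᶠ x' in 𝓝 x, ∀ k ≥ N, φ n k x' = 0 := fun n x => by
    obtain ⟨T, hT, hTfin⟩ := (b n).locallyFinite x
    obtain ⟨N, hN⟩ := hTfin.bddAbove
    refine ⟨N + 1, ?_⟩
    filter_upwards [hT] with x' hx' k hk
    rw [hφ0]
    by_contra h
    exact absurd (hN ⟨x', h, hx'⟩) (by omega)
  choose K hK using fun n x => (hfin n x).imp fun N hN => hN.self_of_nhds
  refine .of_tendsto (by simp) (fun _ => α) (fun n q =>
    equiFold lam z₀ (fun k => φ n k q.1) (fun k => f (p n k q.1, q.2)) (K n q.1))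
    (fun _ => by simp) (fun n => ?_) ?_
  · exact hlam.isBaireClass_equiFold z₀ (h := fun (d : D) y => f (d, y)) (hp n)
      (fun k => (b n k).continuous.subtype_mk _) (fun k x hx => by
        have h1 : x ∉ tsupport (b n k) := fun h => hx (hOW n k (hb n k h))
        filter_upwards [notMem_tsupport_iff_eventuallyEq.1 h1] with x' hx'
        exact (hφ0 n k x').2 hx') (hfin n) (hK n) hα fun d => d.2
  · rintro ⟨x, y⟩
    refine tendsto_def.2 fun N hN => ?_
    -- `M` depends on `c x` but not on `n`, so `n` can be chosen after it.
    obtain ⟨M, hM, hMN⟩ := hlam.exists_nhds_equiFold hN (c x)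
    obtain ⟨ε, hε, hεM⟩ := Metric.mem_nhds_iff.1 ((hfc y).continuousAt (x := x) hM)
    obtain ⟨n₀, hn₀⟩ := exists_nat_one_div_lt hε
    filter_upwards [eventually_ge_atTop n₀] with n hn
    have hfinO : {k | x ∈ O n k}.Finite := finite_of_encard_le_coe (hOc n x)
    refine hMN _ _ _ hfinO.toFinset ?_ (fun k hk => hφO n k x (by simpa using hk))
      (fun k hk => ?_) ?_ _ (hK n x)
    · have := hOc n x
      rw [hfinO.encard_eq_coe_toFinset_card] at this
      exact_mod_cast this
    · refine hεM ?_
      have hk : x ∈ O n k := by simpa using hk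
      exact (hdist n k x (hOW n k hk)).trans_le
        ((Nat.one_div_le_one_div hn).trans hn₀.le)
    · exact ⟨_, Subtype.ext ((b n).ind_apply x (mem_univ x))⟩
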